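/- Conventions. A partial action $\eta$ of a group $G$ on a set $X$ is a map $(g,x)\mapsto g\cdot x$ defined on a subset $G*X\subseteq G\times X$ such that (a) if $g\cdot x$ is defined, then $g^{-1}\cdot(g\cdot x)$ is defined and equals $x$; (b) if $g\cdot(h\cdot x)$ is defined, then $(gh)\cdot x$ is defined and equals $g\cdot(h\cdot x)$; (c) $1\cdot x$ is defined and equals $x$. If $G$ is a topological group and $X$ a topological space, $\eta$ is called continuous and topological if $\eta:G*X\to X$ is continuous for the subspace topology of $G\times X$, every $X_g=\{x\in X: g^{-1}\cdot x\text{ is defined}\}$ is open, and every $\eta_g:X_{g^{-1}}\to X_g$, $x\mapsto g\cdot x$, is a homeomorphism. For partial actions of $G$ on $X$ and $Y$, a $G$-map $f:X\to Y$ is a map such that whenever $g\cdot x$ is defined, $g\cdot f(x)$ is defined and equals $f(g\cdot x)$. A $G$-equivalence is a homeomorphism that is a $G$-map together with its inverse. For a subgroup $H\le G$ write $x\sim_H y$ if $h\cdot x$ is defined and equal to $y$ for some $h\in H$; $X/\!\sim_H$ has the quotient topology and $\pi_H:X\to X/\!\sim_H$ is the quotient map. If $H$ is normal, $G$ acts partially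 on $X/\!\sim_H$ (the induced partial action) as follows: $g\cdot\pi_H(x)$ is defined if and only if $(hg)\cdot x$ is defined for some $h\in H$, and then $g\cdot \pi_H(x)=\pi_H((hg)\cdot x)$. Proposition 4.9. Let $I$ be a non-empty directed set and let $\{G_i;\,p_i^j;\,I\}$ be an inverse system of topological groups, with continuous homomorphisms $p_i^j:G_j\to G_i$ for $i\le j$. Let $G=\varprojlim G_i$, with projections $p_i:G\to G_i$, be its inverse limit as a topological group. Assume that $G$ is compact and that each kernel $H_i=\ker p_i$ is closed in $G$ (as is automatic when the $G_i$ are Hausdorff). Let $\eta$ be a continuous topological partial action of $G$ on a Hausdorff space $X$ such that $G*X$ is closed in $G\times X$. Put $X_i=X/\!\sim_{H_i}$ and let $\varprojlim X_i$ be the inverse limit of the spaces $X_i$ along the maps $\pi_i^j:X_j\to X_i$, $\pi_{H_j}(x)\mapsto\pi_{H_i}(x)$ ($i\le j$). Then the canonical map $\lambda:X\to\varprojlim X_i$, $\lambda(x)=(\pi_{H_i}(x))_{i\in I}$, is a homeomorphism, and there is a continuous topological partial action of $G$ on $\varprojlim X_i$ for which $\lambda$ is a $G$-equivalence and every projection $\varprojlim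 X_i\to X_i$ is a $G$-map for the induced partial action of $G$ on $X_i$. In particular $X$ is $G$-equivalent to $\varprojlim X_i$. -/

import Mathlib

/-- A partial action of a group `G` on a set `X`: a function `(g, x) ↦ g · x` defined on a
subset `dom` (written `G * X`) of `G × X`, such that
* if `g · x` is defined, then `g⁻¹ · (g · x)` is defined and equals `x`;
* if `g · (h · x)` is defined, then `(g h) · x` is defined and equals `g · (h · x)`;
* `1 · x` is defined and equals `x`. -/
structure PartialAction (G X : Type*) [Group G] where
  dom : Set (G × X)
  act : dom → X
  inv_act : ∀ (g : G) (x : X) (hx : (g, x) ∈ dom),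
    ∃ h' : (g⁻¹, act ⟨(g, x), hx⟩) ∈ dom, act ⟨(g⁻¹, act ⟨(g, x), hx⟩), h'⟩ = x
  act_act : ∀ (g h : G) (x : X) (hx : (h, x) ∈ dom) (hgx : (g, act ⟨(h, x), hx⟩) ∈ dom),
    ∃ h' : (g * h, x) ∈ dom,
      act ⟨(g, act ⟨(h, x), hx⟩), hgx⟩ = act ⟨(g * h, x), h'⟩
  one_act : ∀ x : X, ∃ h' : (1, x) ∈ dom, act ⟨(1, x), h'⟩ = x

namespace PartialAction

section Basic

variable {G X Y : Type*} [Group G]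

/-- A partial action of a topological group on a space is continuous and topological if
`(g, x) ↦ g · x` is continuous on `G * X` (with the subspace topology of `G × X`), and every
`X_{g⁻¹} = {x | g · x is defined}` is open. The bijections `x ↦ g · x` from `X_{g⁻¹}` to `X_g`
are then automatically homeomorphisms, `x ↦ g⁻¹ · x` being the inverse of `x ↦ g · x`. -/
structure IsTopological [TopologicalSpace G] [TopologicalSpace X]
    (η : PartialAction G X) : Prop where
  continuous_act : Continuous η.act
  isOpen_dom : ∀ g : G, IsOpen {x : X | (g, x) ∈ η.dom}

/-- `f : X → Y` is a `G`-map: whenever `g · x` is defined, `g · f x` is defined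
and `f (g · x) = g · f x`. -/
def IsGMap (η : PartialAction G X) (ρ : PartialAction G Y) (f : X → Y) : Prop :=
  ∀ (g : G) (x : X) (hx : (g, x) ∈ η.dom),
    ∃ h' : (g, f x) ∈ ρ.dom, f (η.act ⟨(g, x), hx⟩) = ρ.act ⟨(g, f x), h'⟩

/-- A homeomorphism is a `G`-equivalence if it and its inverse are `G`-maps. -/
def IsGEquivalence [TopologicalSpace X] [TopologicalSpace Y]
    (η : PartialAction G X) (ρ : PartialAction G Y) (e : X ≃ₜ Y) : Prop :=
  IsGMap η ρ e ∧ IsGMap ρ η e.symm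

/-- Pull back a partial action of `K` along a homomorphism `φ : G → K`. -/
def comap {K : Type*} [Group K] (η : PartialAction K X) (φ : G →* K) : PartialAction G X where
  dom := {q | (φ q.1, q.2) ∈ η.dom}
  act q := η.act ⟨(φ q.1.1, q.1.2), q.2⟩
  inv_act g x hx := by
    simpa only [Set.mem_ofPred_eq, map_inv] using η.inv_act (φ g) x hx
  act_act g h x hx hgx := by
    simpa only [Set.mem_ofPred_eq, map_mul] using η.act_act (φ g) (φ h) x hx hgx
  one_act x := by
    simpa only [Set.mem_ofPred_eq, map_one] using η.one_act x

/-- The restriction of a partial action of `G` to a subgroup `H`. -/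
def restrict (η : PartialAction G X) (H : Subgroup G) : PartialAction H X :=
  η.comap H.subtype

/-- The orbit equivalence relation: `x ∼ y` iff `g · x` is defined and equal to `y`
for some `g`. -/
def orbitSetoid (η : PartialAction G X) : Setoid X where
  r x y := ∃ (g : G) (hx : (g, x) ∈ η.dom), η.act ⟨(g, x), hx⟩ = y
  iseqv :=
    { refl := fun x => ⟨1, η.one_act x⟩
      symm := by
        rintro x y ⟨g, hx, rfl⟩
        exact ⟨g⁻¹, η.inv_act g x hx⟩
      trans := by
        rintro x y z ⟨g, hx, rfl⟩ ⟨k, hy, rfl⟩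
        obtain ⟨h', e⟩ := η.act_act k g x hx hy
        exact ⟨k * g, h', e.symm⟩ }

/-- The orbit space `X/∼_H` of the restriction of `η` to the subgroup `H`. -/
def OrbitSpace (η : PartialAction G X) (H : Subgroup G) : Type _ :=
  Quotient (η.restrict H).orbitSetoid

/-- Orbit spaces carry the quotient topology. -/
instance [TopologicalSpace X] (η : PartialAction G X) (H : Subgroup G) :
    TopologicalSpace (OrbitSpace η H) :=
  inferInstanceAs (TopologicalSpace (Quotient (η.restrict H).orbitSetoid))

/-- The quotient map `π_H : X → X/∼_H`. -/
def orbitMk (η : PartialAction G X) (H : Subgroup G) (x : X) : OrbitSpace η H :=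
  Quotient.mk (η.restrict H).orbitSetoid x

/-- For `H₁ ≤ H₂`, the map `X/∼_{H₁} → X/∼_{H₂}`, `π_{H₁} x ↦ π_{H₂} x`. -/
def orbitMap (η : PartialAction G X) {H₁ H₂ : Subgroup G} (h : H₁ ≤ H₂) :
    OrbitSpace η H₁ → OrbitSpace η H₂ :=
  Quotient.lift (s := (η.restrict H₁).orbitSetoid) (orbitMk η H₂) (by
    rintro x y ⟨k, hx, e⟩
    exact Quotient.sound (s := (η.restrict H₂).orbitSetoid) ⟨⟨k.1, h k.2⟩, hx, e⟩)

theorem orbitMk_eq_iff (η : PartialAction G X) (H : Subgroup G) {x y : X} :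
    orbitMk η H x = orbitMk η H y ↔
      ∃ k ∈ H, ∃ hx : (k, x) ∈ η.dom, η.act ⟨(k, x), hx⟩ = y := by
  constructor
  · intro h
    obtain ⟨k, hx, e⟩ := Quotient.exact (s := (η.restrict H).orbitSetoid) h
    exact ⟨k.1, k.2, hx, e⟩
  · rintro ⟨k, hk, hx, e⟩
    exact Quotient.sound (s := (η.restrict H).orbitSetoid) ⟨⟨k, hk⟩, hx, e⟩

/-- If `g · x` and `(k g) · x` are defined, so is `k · (g · x)`, and it equals `(k g) · x`. -/
theorem act_of_mul (η : PartialAction G X) (k g : G) (x : X) (hx : (g, x) ∈ η.dom)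
    (hkx : (k * g, x) ∈ η.dom) : ∃ h' : (k, η.act ⟨(g, x), hx⟩) ∈ η.dom,
      η.act ⟨(k, η.act ⟨(g, x), hx⟩), h'⟩ = η.act ⟨(k * g, x), hkx⟩ := by
  obtain ⟨h1, e1⟩ := η.inv_act g x hx
  generalize η.act ⟨(g, x), hx⟩ = y at h1 e1 ⊢
  subst e1
  obtain ⟨h2, e2⟩ := η.act_act (k * g) g⁻¹ y h1 hkx
  rw [e2]
  simp only [mul_inv_cancel_right] at h2 ⊢
  exact ⟨h2, trivial⟩

theorem orbitMk_act_congr (η : PartialAction G X) (H : Subgroup G) [H.Normal] {g g' : G}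
    {x x' : X} (hx : (g, x) ∈ η.dom) (hx' : (g', x') ∈ η.dom)
    (hg : (g : G ⧸ H) = g') (hxx : orbitMk η H x = orbitMk η H x') :
    orbitMk η H (η.act ⟨(g, x), hx⟩) = orbitMk η H (η.act ⟨(g', x'), hx'⟩) := by
  obtain ⟨k, hk, hkx, rfl⟩ := (orbitMk_eq_iff η H).1 hxx
  obtain ⟨h1, e1⟩ := η.act_act g' k x hkx hx'
  rw [e1, orbitMk_eq_iff]
  have hm : g' * k = (g' * k * g⁻¹) * g := by group
  have hH : g' * k * g⁻¹ ∈ H := by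
    rw [← QuotientGroup.eq_one_iff, QuotientGroup.mk_mul, QuotientGroup.mk_mul, ← hg,
      (QuotientGroup.eq_one_iff k).2 hk, mul_one, ← QuotientGroup.mk_mul, mul_inv_cancel,
      QuotientGroup.mk_one]
  refine ⟨_, hH, ?_⟩
  obtain ⟨h2, e2⟩ := η.act_of_mul (g' * k * g⁻¹) g x hx (hm ▸ h1)
  refine ⟨h2, e2.trans ?_⟩
  congr 3
  exact hm.symm

/-- The partial action of `G/H` on `X/∼_H` induced by `η`, for `H` normal in `G`:
`gH · π_H x` is defined iff `(h g) · x` is defined for some `h ∈ H`, and then it is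
`π_H ((h g) · x)`. As `h g H = g H`, the domain is the image of `G * X` in `G/H × X/∼_H`. -/
noncomputable def quotientAction (η : PartialAction G X) (H : Subgroup G) [H.Normal] :
    PartialAction (G ⧸ H) (OrbitSpace η H) where
  dom := {q | ∃ (g : G) (x : X), (g, x) ∈ η.dom ∧ ((g : G ⧸ H), orbitMk η H x) = q}
  act q := orbitMk η H
    (η.act ⟨(q.2.choose, q.2.choose_spec.choose), q.2.choose_spec.choose_spec.1⟩)
  inv_act q z hz := by
    have key : ∀ (g : G) (x : X) (hx : (g, x) ∈ η.dom), ((g : G ⧸ H), orbitMk η H x) = (q, z) →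
        orbitMk η H (η.act ⟨(hz.choose, hz.choose_spec.choose),
          hz.choose_spec.choose_spec.1⟩) = orbitMk η H (η.act ⟨(g, x), hx⟩) := by
      intro g x hx e
      have e' := hz.choose_spec.choose_spec.2.trans e.symm
      exact orbitMk_act_congr η H _ hx (congrArg Prod.fst e') (congrArg Prod.snd e')
    obtain ⟨g, x, hx, e⟩ := id hz
    obtain ⟨h1, e1⟩ := η.inv_act g x hx
    have h2 : ∃ (g' : G) (x' : X), (g', x') ∈ η.dom ∧ ((g' : G ⧸ H), orbitMk η H x') =
        (q⁻¹, orbitMk η H (η.act ⟨(hz.choose, hz.choose_spec.choose),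
          hz.choose_spec.choose_spec.1⟩)) := by
      refine ⟨g⁻¹, _, h1, ?_⟩
      rw [key g x hx e, QuotientGroup.mk_inv]
      exact congrArg (fun c => (c⁻¹, orbitMk η H (η.act ⟨(g, x), hx⟩))) (congrArg Prod.fst e)
    refine ⟨h2, ?_⟩
    have e3 := h2.choose_spec.choose_spec.2
    have e4 := orbitMk_act_congr η H h2.choose_spec.choose_spec.1 h1
      ((congrArg Prod.fst e3).trans
        (by rw [QuotientGroup.mk_inv]; exact congrArg (·⁻¹) (congrArg Prod.fst e).symm))
      ((congrArg Prod.snd e3).trans (key g x hx e))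
    exact e4.trans ((congrArg (orbitMk η H) e1).trans (congrArg Prod.snd e))
  act_act q r z hz hqz := by
    obtain ⟨g, x, hx, e⟩ := id hz
    obtain ⟨k, y, hy, e'⟩ := id hqz
    have ez := hz.choose_spec.choose_spec.2
    have key : orbitMk η H (η.act ⟨(hz.choose, hz.choose_spec.choose),
          hz.choose_spec.choose_spec.1⟩) = orbitMk η H (η.act ⟨(g, x), hx⟩) :=
      orbitMk_act_congr η H _ hx (congrArg Prod.fst (ez.trans e.symm))
        (congrArg Prod.snd (ez.trans e.symm))
    obtain ⟨a, ha, hax, ea⟩ := (orbitMk_eq_iff η H).1 (((congrArg Prod.snd e').trans key).symm)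
    subst ea
    obtain ⟨h1, e1⟩ := η.act_act a g x hx hax
    have hy' := hy
    rw [e1] at hy'
    obtain ⟨h2, e2⟩ := η.act_act k (a * g) x h1 hy'
    have em : ((k * (a * g) : G) : G ⧸ H) = q * r := by
      rw [QuotientGroup.mk_mul, QuotientGroup.mk_mul, (QuotientGroup.eq_one_iff a).2 ha, one_mul]
      exact congrArg₂ (· * ·) (congrArg Prod.fst e') (congrArg Prod.fst e)
    have h3 : ∃ (g' : G) (x' : X), (g', x') ∈ η.dom ∧
        ((g' : G ⧸ H), orbitMk η H x') = (q * r, z) :=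
      ⟨_, x, h2, Prod.ext em (show orbitMk η H x = z from congrArg Prod.snd e)⟩
    refine ⟨h3, ?_⟩
    have e3 := hqz.choose_spec.choose_spec.2.trans e'.symm
    have e4 := h3.choose_spec.choose_spec.2
    have l := orbitMk_act_congr η H hqz.choose_spec.choose_spec.1 hy
      (congrArg Prod.fst e3) (congrArg Prod.snd e3)
    have r' := orbitMk_act_congr η H h3.choose_spec.choose_spec.1 h2
      ((congrArg Prod.fst e4).trans em.symm)
      ((congrArg Prod.snd e4).trans (congrArg Prod.snd e).symm)
    refine l.trans (Eq.trans ?_ r'.symm)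
    rw [← e2]
    congr 3
    simp only [e1]
  one_act z := by
    obtain ⟨x, rfl⟩ : ∃ x, orbitMk η H x = z := Quotient.exists_rep z
    obtain ⟨h1, e1⟩ := η.one_act x
    have h2 : ∃ (g' : G) (x' : X), (g', x') ∈ η.dom ∧
        ((g' : G ⧸ H), orbitMk η H x') = (1, orbitMk η H x) := ⟨1, x, h1, rfl⟩
    refine ⟨h2, ?_⟩
    have e := h2.choose_spec.choose_spec.2
    exact (orbitMk_act_congr η H h2.choose_spec.choose_spec.1 h1
      (congrArg Prod.fst e) (congrArg Prod.snd e)).trans (congrArg (orbitMk η H) e1)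

theorem mem_quotientAction_dom (η : PartialAction G X) (H : Subgroup G) [H.Normal] (g : G)
    (x : X) : ((g : G ⧸ H), orbitMk η H x) ∈ (quotientAction η H).dom ↔
      ∃ h ∈ H, (h * g, x) ∈ η.dom := by
  constructor
  · rintro ⟨k, y, hy, e⟩
    obtain ⟨a, ha, hax, ea⟩ := (orbitMk_eq_iff η H).1 (congrArg Prod.snd e).symm
    subst ea
    obtain ⟨h1, e1⟩ := η.act_act k a x hax hy
    refine ⟨k * a * g⁻¹, ?_, by simpa using h1⟩
    rw [← QuotientGroup.eq_one_iff, QuotientGroup.mk_mul, QuotientGroup.mk_mul,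
      (QuotientGroup.eq_one_iff a).2 ha, mul_one, show (k : G ⧸ H) = g from congrArg Prod.fst e,
      ← QuotientGroup.mk_mul, mul_inv_cancel, QuotientGroup.mk_one]
  · rintro ⟨h, hh, hx⟩
    refine ⟨h * g, x, hx, Prod.ext ?_ rfl⟩
    change ((h * g : G) : G ⧸ H) = g
    rw [QuotientGroup.mk_mul, (QuotientGroup.eq_one_iff h).2 hh, one_mul]

theorem quotientAction_act (η : PartialAction G X) (H : Subgroup G) [H.Normal] (g : G)
    (x : X) (h : G) (hh : h ∈ H) (hx : (h * g, x) ∈ η.dom)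
    (hq : ((g : G ⧸ H), orbitMk η H x) ∈ (quotientAction η H).dom) :
    (quotientAction η H).act ⟨_, hq⟩ = orbitMk η H (η.act ⟨(h * g, x), hx⟩) := by
  have e := hq.choose_spec.choose_spec.2
  refine orbitMk_act_congr η H hq.choose_spec.choose_spec.1 hx
    ((congrArg Prod.fst e).trans ?_) (congrArg Prod.snd e)
  change (g : G ⧸ H) = ((h * g : G) : G ⧸ H)
  rw [QuotientGroup.mk_mul, (QuotientGroup.eq_one_iff h).2 hh, one_mul]

/-- The partial action of `G` on `X/∼_H`, for `H` normal in `G`: that of `G/H`, pulled back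
along the canonical homomorphism `G → G/H`. -/
noncomputable def inducedAction (η : PartialAction G X) (H : Subgroup G) [H.Normal] :
    PartialAction G (OrbitSpace η H) :=
  (quotientAction η H).comap (QuotientGroup.mk' H)

end Basic

end PartialAction

section Limits

variable {I : Type*} [Preorder I]

/-- The inverse limit of the `F i` along the maps `f : F j → F i` (`i ≤ j`): the compatible
families in the product. On topological spaces it has the subspace topology of the product
topology. -/
def InverseLimit {F : I → Type*} (f : ∀ ⦃i j : I⦄, i ≤ j → F j → F i) : Type _ :=
  {x : ∀ i, F i // ∀ ⦃i j : I⦄ (h : i ≤ j), f h (x j) = x i}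

instance {F : I → Type*} [∀ i, TopologicalSpace (F i)]
    (f : ∀ ⦃i j : I⦄, i ≤ j → F j → F i) : TopologicalSpace (InverseLimit f) :=
  inferInstanceAs (TopologicalSpace {x : ∀ i, F i // ∀ ⦃i j : I⦄ (h : i ≤ j), f h (x j) = x i})

variable {Γ : I → Type*} [∀ i, Group (Γ i)] [∀ i, TopologicalSpace (Γ i)]
  {G : Type*} [Group G] [TopologicalSpace G]

/-- The topological group `G`, with the continuous homomorphisms `p i : G → Γ i`, is an inverse
limit of the inverse system of topological groups `(Γ i, t)`: the `p i` are compatible with the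
transition maps `t`, and `g ↦ (p i g)ᵢ` is a homeomorphism (hence an isomorphism of topological
groups) from `G` onto the group of compatible families. -/
structure IsInverseLimit (t : ∀ ⦃i j : I⦄, i ≤ j → Γ j →ₜ* Γ i) (p : ∀ i, G →ₜ* Γ i) : Prop where
  compat : ∀ ⦃i j : I⦄ (h : i ≤ j) (g : G), t h (p j g) = p i g
  isHomeomorph : IsHomeomorph
    (fun g : G => (⟨fun i => p i g, fun _ _ h => compat h g⟩ :
      InverseLimit (fun i j (h : i ≤ j) => ⇑(t h))))

/-- The kernel `H_i` of the projection `p i : G → Γ i`. -/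
abbrev projKer (p : ∀ i, G →ₜ* Γ i) (i : I) : Subgroup G := (p i).toMonoidHom.ker

/-- `H_j ≤ H_i` for `i ≤ j`. -/
theorem IsInverseLimit.projKer_le {t : ∀ ⦃i j : I⦄, i ≤ j → Γ j →ₜ* Γ i} {p : ∀ i, G →ₜ* Γ i}
    (hp : IsInverseLimit t p) ⦃i j : I⦄ (h : i ≤ j) : projKer p j ≤ projKer p i := by
  intro g hg
  have hg' : p j g = 1 := hg
  change p i g = 1
  rw [← hp.compat h, hg', map_one]

/-- The inverse limit of the orbit spaces `X_i = X/∼_{H_i}` along the maps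
`X/∼_{H_j} → X/∼_{H_i}` (`i ≤ j`). -/
abbrev OrbitLimit {t : ∀ ⦃i j : I⦄, i ≤ j → Γ j →ₜ* Γ i} {p : ∀ i, G →ₜ* Γ i}
    (hp : IsInverseLimit t p) {X : Type*} (η : PartialAction G X) : Type _ :=
  InverseLimit (F := fun i => η.OrbitSpace (projKer p i))
    (fun _ _ h => η.orbitMap (hp.projKer_le h))

end Limits

/-! The kernels `H_i` are closed, directed downwards and meet only in `1`; as `G` is compact, a
closed subset of `G` meeting every `H_i` contains `1`
(`IsInverseLimit.one_mem_of_forall_inter_nonempty`). For closed `C ⊆ X` the set of `g` with `g · x`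
defined and in `C` is closed. Taking `C = {y}` shows that `λ` is injective; taking for `C` the
complement of a neighbourhood `U` of `x` shows that some `H_i`-orbit of `x` lies in `U`.

A point of the limit is a directed family of orbits. These are compact, hence closed in the
Hausdorff space `X`, so they share a point, and `λ` is surjective.

For openness, the points whose `H_i`-orbit lies in `U` form a saturated open set
(`isOpen_setOf_orbit_subset`), and its open image in `X_i` cuts out a neighbourhood inside `λ(U)`.
The action on the limit is then the one carried over by `λ`. -/

namespace PartialAction

/-! ### Transport of partial actions -/

section Transport

variable {G X Y : Type*} [Group G]

/-- Transport a partial action along a bijection. -/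
def transport (η : PartialAction G X) (e : X ≃ Y) : PartialAction G Y where
  dom := {q | (q.1, e.symm q.2) ∈ η.dom}
  act q := e (η.act ⟨(q.1.1, e.symm q.1.2), q.2⟩)
  inv_act g y hy := by
    obtain ⟨h, hh⟩ := η.inv_act g (e.symm y) hy
    refine ⟨by simpa using h, ?_⟩
    simp only [Equiv.symm_apply_apply, hh, Equiv.apply_symm_apply]
  act_act g k y hy hgy := by
    obtain ⟨h, hh⟩ := η.act_act g k (e.symm y) hy (by simpa using hgy)
    refine ⟨h, ?_⟩
    simp only [Equiv.symm_apply_apply, hh]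
  one_act y := by
    obtain ⟨h, hh⟩ := η.one_act (e.symm y)
    exact ⟨h, by simp only [hh, Equiv.apply_symm_apply]⟩

theorem IsTopological.transport [TopologicalSpace G] [TopologicalSpace X] [TopologicalSpace Y]
    {η : PartialAction G X} (hη : η.IsTopological) (e : X ≃ₜ Y) :
    (η.transport e.toEquiv).IsTopological where
  continuous_act := by
    refine e.continuous.comp (hη.continuous_act.comp (Continuous.subtype_mk ?_ _))
    exact (continuous_fst.comp continuous_subtype_val).prodMk
      (e.symm.continuous.comp (continuous_snd.comp continuous_subtype_val))
  isOpen_dom g := (hη.isOpen_dom g).preimage e.symm.continuous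

theorem isGEquivalence_transport [TopologicalSpace X] [TopologicalSpace Y]
    (η : PartialAction G X) (e : X ≃ₜ Y) :
    IsGEquivalence η (η.transport e.toEquiv) e := by
  constructor
  · intro g x hx
    refine ⟨show (g, e.symm (e x)) ∈ η.dom by simpa using hx, ?_⟩
    change e _ = e (η.act ⟨(g, e.symm (e x)), _⟩)
    simp only [Homeomorph.symm_apply_apply]
  · intro g y hy
    exact ⟨hy, e.symm_apply_apply _⟩

end Transport

/-! ### Topology of orbits and orbit spaces -/

section Topology

variable {G X : Type*} [Group G] [TopologicalSpace X]

theorem continuous_orbitMk (η : PartialAction G X) (H : Subgroup G) :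
    Continuous (η.orbitMk H) :=
  continuous_quot_mk

/-- A saturated set is the preimage of its image, so the quotient topology decides. -/
theorem isOpen_orbitMk_image_of_saturated (η : PartialAction G X) (H : Subgroup G) {V : Set X}
    (hV : IsOpen V) (hsat : ∀ x ∈ V, ∀ y, η.orbitMk H x = η.orbitMk H y → y ∈ V) :
    IsOpen (η.orbitMk H '' V) := by
  have hq : Topology.IsQuotientMap (η.orbitMk H) := isQuotientMap_quot_mk
  rw [← hq.isOpen_preimage]
  convert hV
  ext y
  exact ⟨fun ⟨x, hx, e⟩ => hsat x hx y e, fun hy => ⟨y, hy, rfl⟩⟩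

variable [TopologicalSpace G] {η : PartialAction G X}

/-- Continuity gives a set closed in `η.dom`; since `η.dom` is closed, it is closed in `G × X`. -/
theorem isClosed_setOf_act_mem (hη : η.IsTopological) (hclosed : IsClosed η.dom) {C : Set X}
    (hC : IsClosed C) : IsClosed {q : G × X | ∃ hq : q ∈ η.dom, η.act ⟨q, hq⟩ ∈ C} := by
  convert hclosed.isClosedEmbedding_subtypeVal.isClosedMap _ (hC.preimage hη.continuous_act)
  ext q
  simp

theorem isClosed_setOf_act_mem_left (hη : η.IsTopological) (hclosed : IsClosed η.dom) {C : Set X}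
    (hC : IsClosed C) (x : X) :
    IsClosed {g : G | ∃ hg : (g, x) ∈ η.dom, η.act ⟨(g, x), hg⟩ ∈ C} :=
  (isClosed_setOf_act_mem hη hclosed hC).preimage (Continuous.prodMk_left x)

/-- The orbit is the continuous image, under `g ↦ g · x`, of a closed subset of the compact group.
-/
theorem isCompact_orbit [CompactSpace G] (hη : η.IsTopological) (hclosed : IsClosed η.dom)
    {H : Subgroup G} (hH : IsClosed (H : Set G)) (x : X) :
    IsCompact {y | η.orbitMk H x = η.orbitMk H y} := by
  have hc : IsCompact ({g : G | (g, x) ∈ η.dom} ∩ H) :=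
    ((hclosed.preimage (Continuous.prodMk_left x)).inter hH).isCompact
  have hcont : Continuous fun g : ↥({g : G | (g, x) ∈ η.dom} ∩ H) => η.act ⟨(g.1, x), g.2.1⟩ :=
    hη.continuous_act.comp
      (((Continuous.prodMk_left x).comp continuous_subtype_val).subtype_mk _)
  have := isCompact_iff_compactSpace.1 hc
  convert isCompact_range hcont
  ext y
  simp only [Set.mem_ofPred_eq, orbitMk_eq_iff, Set.mem_range, Subtype.exists]
  exact ⟨fun ⟨k, hk, hx, e⟩ => ⟨k, ⟨hx, hk⟩, e⟩, fun ⟨k, ⟨hx, hk⟩, e⟩ => ⟨k, hk, hx, e⟩⟩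

/-- The set of points whose `H`-orbit lies in an open set is open, for `H` compact. -/
theorem isOpen_setOf_orbit_subset [CompactSpace G] (hη : η.IsTopological)
    (hclosed : IsClosed η.dom) {H : Subgroup G} (hH : IsClosed (H : Set G)) {U : Set X}
    (hU : IsOpen U) : IsOpen {x | ∀ y, η.orbitMk H x = η.orbitMk H y → y ∈ U} := by
  -- The complement is the projection to `X` of the closed set of pairs `(g, x)` with `g ∈ H` and `g
  -- · x` defined outside `U`; projecting along a compact factor is a closed map.
  have h := isClosedMap_snd_of_compactSpace (X := G) (Y := X) _
    ((isClosed_setOf_act_mem hη hclosed hU.isClosed_compl).inter (hH.preimage continuous_fst))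
  convert h.isOpen_compl
  ext x
  simp only [Set.mem_ofPred_eq, Set.mem_compl_iff, Set.mem_image, not_exists]
  constructor
  · rintro h ⟨g, _⟩ ⟨⟨⟨hg, hgU⟩, hgH⟩, rfl⟩
    exact hgU (h _ ((orbitMk_eq_iff η H).2 ⟨g, hgH, hg, rfl⟩))
  · intro h y hy
    obtain ⟨k, hk, hx, rfl⟩ := (orbitMk_eq_iff η H).1 hy
    by_contra hyU
    exact h (k, x) ⟨⟨⟨hx, hyU⟩, hk⟩, rfl⟩

end Topology

end PartialAction

/-! ### Passage to the limit over the kernels -/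

section Limits

variable {I : Type*} [Preorder I] {Γ : I → Type*} [∀ i, Group (Γ i)]
  [∀ i, TopologicalSpace (Γ i)] {G : Type*} [Group G] [TopologicalSpace G]
  {t : ∀ ⦃i j : I⦄, i ≤ j → Γ j →ₜ* Γ i} {p : ∀ i, G →ₜ* Γ i}

theorem IsInverseLimit.eq_one (hp : IsInverseLimit t p) {g : G} (hg : ∀ i, g ∈ projKer p i) :
    g = 1 := by
  apply hp.isHomeomorph.injective
  refine Subtype.ext (funext fun i => ?_)
  exact (show p i g = 1 from hg i).trans (map_one (p i)).symm

/-- A closed set meeting all the kernels contains `1`. -/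
theorem IsInverseLimit.one_mem_of_forall_inter_nonempty [IsDirectedOrder I] [Nonempty I]
    [CompactSpace G] (hp : IsInverseLimit t p)
    (hker : ∀ i, IsClosed (projKer p i : Set G)) {K : Set G} (hK : IsClosed K)
    (h : ∀ i, (K ∩ projKer p i).Nonempty) : 1 ∈ K := by
  obtain ⟨g, hg⟩ := IsCompact.nonempty_iInter_of_directed_nonempty_isCompact_isClosed
    (fun i => K ∩ projKer p i)
    (directed_of_isDirected_le fun i j hij =>
      Set.inter_subset_inter_right K (hp.projKer_le hij)) h
    (fun i => (hK.inter (hker i)).isCompact) (fun i => hK.inter (hker i))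
  rw [Set.mem_iInter] at hg
  -- Some index is needed to read off `g ∈ K`: an empty intersection would be all of `G`.
  obtain ⟨i⟩ := ‹Nonempty I›
  exact hp.eq_one (fun i => (hg i).2) ▸ (hg i).1

variable {X : Type*} [TopologicalSpace X] {η : PartialAction G X}

/-- The canonical map from `X` to the inverse limit of its orbit spaces. -/
def toOrbitLimit (hp : IsInverseLimit t p) (η : PartialAction G X) (x : X) : OrbitLimit hp η :=
  ⟨fun i => η.orbitMk (projKer p i) x, fun _ _ _ => rfl⟩

theorem continuous_toOrbitLimit (hp : IsInverseLimit t p) (η : PartialAction G X) :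
    Continuous (toOrbitLimit hp η) :=
  (continuous_pi fun i => η.continuous_orbitMk (projKer p i)).subtype_mk _

variable [IsDirectedOrder I] [Nonempty I] [CompactSpace G]

theorem toOrbitLimit_injective [T1Space X] (hp : IsInverseLimit t p)
    (hker : ∀ i, IsClosed (projKer p i : Set G)) (hη : η.IsTopological)
    (hclosed : IsClosed η.dom) : Function.Injective (toOrbitLimit hp η) := by
  intro x y hxy
  obtain ⟨h, e⟩ := hp.one_mem_of_forall_inter_nonempty hker
    (PartialAction.isClosed_setOf_act_mem_left hη hclosed (isClosed_singleton (x := y)) x)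
    (fun i => by
      obtain ⟨k, hk, hx, e⟩ := (PartialAction.orbitMk_eq_iff η _).1
        (congrFun (congrArg Subtype.val hxy) i)
      exact ⟨k, ⟨hx, e⟩, hk⟩)
  obtain ⟨_, e'⟩ := η.one_act x
  exact e'.symm.trans e

theorem toOrbitLimit_surjective [T2Space X] (hp : IsInverseLimit t p)
    (hker : ∀ i, IsClosed (projKer p i : Set G)) (hη : η.IsTopological)
    (hclosed : IsClosed η.dom) : Function.Surjective (toOrbitLimit hp η) := by
  intro z
  have hrep : ∀ i, ∃ x, η.orbitMk (projKer p i) x = z.1 i := fun i => Quotient.exists_rep (z.1 i)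
  -- The fibre over `z.1 i` is a single `H_i`-orbit.
  have hc : ∀ i, IsCompact {y | z.1 i = η.orbitMk (projKer p i) y} := fun i => by
    obtain ⟨x, hx⟩ := hrep i
    rw [← hx]
    exact PartialAction.isCompact_orbit hη hclosed (hker i) x
  obtain ⟨x, hx⟩ := IsCompact.nonempty_iInter_of_directed_nonempty_isCompact_isClosed
    (fun i => {y | z.1 i = η.orbitMk (projKer p i) y})
    (directed_of_isDirected_le fun i j hij y hy =>
      (z.2 hij).symm.trans (congrArg (η.orbitMap (hp.projKer_le hij)) hy))
    (fun i => (hrep i).imp fun _ => Eq.symm) hc (fun i => (hc i).isClosed)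
  rw [Set.mem_iInter] at hx
  exact ⟨x, Subtype.ext (funext fun i => (hx i).symm)⟩

/-- Otherwise the closed set of `g` moving `x` out of `U` meets every kernel, so it contains `1`,
although `1 · x = x ∈ U`. -/
theorem exists_orbit_projKer_subset (hp : IsInverseLimit t p)
    (hker : ∀ i, IsClosed (projKer p i : Set G)) (hη : η.IsTopological)
    (hclosed : IsClosed η.dom) {U : Set X} (hU : IsOpen U) {x : X} (hx : x ∈ U) :
    ∃ i, ∀ y, η.orbitMk (projKer p i) x = η.orbitMk (projKer p i) y → y ∈ U := by
  by_contra! hcon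
  obtain ⟨h, e⟩ := hp.one_mem_of_forall_inter_nonempty hker
    (PartialAction.isClosed_setOf_act_mem_left hη hclosed hU.isClosed_compl x)
    (fun i => by
      obtain ⟨y, hy, hyU⟩ := hcon i
      obtain ⟨k, hk, hx, rfl⟩ := (PartialAction.orbitMk_eq_iff η _).1 hy
      exact ⟨k, ⟨hx, hyU⟩, hk⟩)
  obtain ⟨_, e'⟩ := η.one_act x
  exact e (e'.symm ▸ hx)

theorem isOpenMap_toOrbitLimit [T2Space X] (hp : IsInverseLimit t p)
    (hker : ∀ i, IsClosed (projKer p i : Set G)) (hη : η.IsTopological)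
    (hclosed : IsClosed η.dom) : IsOpenMap (toOrbitLimit hp η) := by
  intro U hU
  rw [isOpen_iff_mem_nhds]
  rintro _ ⟨x, hx, rfl⟩
  obtain ⟨i, hi⟩ := exists_orbit_projKer_subset hp hker hη hclosed hU hx
  have hV := PartialAction.isOpen_setOf_orbit_subset hη hclosed (hker i) hU
  have hVi := η.isOpen_orbitMk_image_of_saturated (projKer p i) hV
    (fun a ha b hab c hc => ha c (hab.trans hc))
  have hcont : Continuous fun z : OrbitLimit hp η => z.1 i :=
    (continuous_apply i).comp continuous_subtype_val
  -- A condition on the single coordinate `i` suffices: if `y` shares its `H_i`-orbit with a point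
  -- whose orbit lies in `U`, then `y ∈ U`.
  refine Filter.mem_of_superset ((hVi.preimage hcont).mem_nhds ⟨x, hi, rfl⟩) ?_
  intro z hz
  obtain ⟨y, rfl⟩ := toOrbitLimit_surjective hp hker hη hclosed z
  obtain ⟨a, ha, e⟩ := hz
  exact ⟨y, ha y e, rfl⟩

end Limits

theorem proposition4p9
    {I : Type*} [Preorder I] [IsDirectedOrder I] [Nonempty I]
    {Γ : I → Type*} [∀ i, Group (Γ i)] [∀ i, TopologicalSpace (Γ i)]
    [∀ i, IsTopologicalGroup (Γ i)]
    (t : ∀ ⦃i j : I⦄, i ≤ j → Γ j →ₜ* Γ i)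
    (ht : InverseSystem (fun i j (h : i ≤ j) => ⇑(t h)))
    {G : Type*} [Group G] [TopologicalSpace G] [IsTopologicalGroup G] [CompactSpace G]
    (p : ∀ i, G →ₜ* Γ i) (hp : IsInverseLimit t p)
    (hker : ∀ i, IsClosed (projKer p i : Set G))
    {X : Type*} [TopologicalSpace X] [T2Space X]
    (η : PartialAction G X) (hη : η.IsTopological) (hclosed : IsClosed η.dom) :
    ∃ e : X ≃ₜ OrbitLimit hp η,
      (∀ (x : X) (i : I), (e x).1 i = η.orbitMk (projKer p i) x) ∧
      ∃ θ : PartialAction G (OrbitLimit hp η), θ.IsTopological ∧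
        PartialAction.IsGEquivalence η θ e ∧
        ∀ i, PartialAction.IsGMap θ (η.inducedAction (projKer p i)) (fun z => z.1 i) := by
  let e : X ≃ₜ OrbitLimit hp η := IsHomeomorph.homeomorph (toOrbitLimit hp η)
    ⟨continuous_toOrbitLimit hp η, isOpenMap_toOrbitLimit hp hker hη hclosed,
      toOrbitLimit_injective hp hker hη hclosed, toOrbitLimit_surjective hp hker hη hclosed⟩
  refine ⟨e, fun _ _ => rfl, η.transport e.toEquiv, hη.transport e,
    η.isGEquivalence_transport e, fun i g z hz => ?_⟩
  obtain ⟨x, rfl⟩ := e.surjective z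
  have hx : (g, x) ∈ η.dom := by
    have h : (g, e.symm (e x)) ∈ η.dom := hz
    rwa [e.symm_apply_apply] at h
  -- Since `g · x` itself is defined, `h = 1` serves as the element of `H_i` in the description of
  -- the induced action.
  have hx' : (1 * g, x) ∈ η.dom := by rwa [one_mul]
  have hq : ((g : G ⧸ projKer p i), η.orbitMk (projKer p i) x) ∈
      (η.quotientAction (projKer p i)).dom :=
    (η.mem_quotientAction_dom _ g x).2 ⟨1, one_mem _, hx'⟩
  refine ⟨hq, ?_⟩
  refine Eq.trans ?_ (η.quotientAction_act _ g x 1 (one_mem _) hx' hq).symm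
  change η.orbitMk (projKer p i) (η.act ⟨(g, e.symm (e x)), _⟩) = _
  simp only [e.symm_apply_apply, one_mul]
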